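/- Theorem (SISP with data $(G,\Lambda)$). Let $G$ be a simple graph, not necessarily locally finite, on a countably infinite vertex set, and let $\Lambda\subset\mathbb R$ be an infinite compact set. A symmetric real matrix $A$, finite or indexed by $\mathbb N=\{1,2,\dots\}$, is said to have graph $H$ (a graph on its index set) if for all $i\ne j$ one has $A_{ij}\neq 0$ exactly when $i$ and $j$ are adjacent in $H$; the diagonal entries are unrestricted. Label the vertices of $G$ by $\mathbb N$ in any way. Then there is a bounded self-adjoint operator $T$ on the complex Hilbert space $\ell^2(\mathbb N)$ such that (i) the spectrum of $T$ and the approximate point spectrum of $T$ are both equal to $\Lambda$, and (ii) the matrix of $T$ with respect to the standard Hilbert basis is real and symmetric and has graph $G$. Moreover, $\Lambda$ has a countable dense subset that can be listed without repetition as $\lambda_1,\lambda_2,\dots$, and for every such listing $T$ can be chosen as follows. There are real symmetric $n\times n$ matrices $\widetilde A_n$ such that $\widetilde A_n$ has as its graph the subgraph of $G$ induced on the vertices $1,\dots,n$ and has spectrum $\{\lambda_1,\dots,\lambda_n\}$, and there are bounded operators $T_n$ on $\ell^2(\mathbb N)$ with standard matrices $\widetilde A_n\oplus\operatorname{diag}(\lambda_{n+1},\lambda_{n+2},\dots)$,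 such that $\|T_{n+1}-T_n\|_{\mathrm{op}}<2^{-n}$ for all $n$ and $T_n\to T$ in operator norm. -/

import Mathlib

open Filter Topology

/-- The complex Hilbert space `ℓ²(ℕ)` of square-summable sequences. -/
abbrev EllTwo : Type := lp (fun _ : ℕ => ℂ) 2

/-- The `j`-th vector of the standard Hilbert basis of `ℓ²(ℕ)`. -/
noncomputable def stdVec (j : ℕ) : EllTwo :=
  lp.single (E := fun _ : ℕ => ℂ) 2 j (1 : ℂ)

/-- The real matrix `M` is the standard matrix of `T`: its `j`-th column lists the coordinates
of `T e_j`. -/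
def HasStandardMatrix (T : EllTwo →L[ℂ] EllTwo) (M : Matrix ℕ ℕ ℝ) : Prop :=
  ∀ i j : ℕ, (T (stdVec j) : ℕ → ℂ) i = (M i j : ℂ)

/-- `G` is the graph of the matrix `M`: off the diagonal, the nonzero entries are exactly those
at adjacent pairs of vertices. -/
def HasGraph {ι : Type*} (M : Matrix ι ι ℝ) (G : SimpleGraph ι) : Prop :=
  ∀ i j : ι, i ≠ j → (M i j ≠ 0 ↔ G.Adj i j)

/-- `HasGraph` may be tested on the principal submatrices and induced subgraphs
of all nonempty finite sets of indices. -/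
theorem hasGraph_iff_finite {ι : Type*} (M : Matrix ι ι ℝ) (G : SimpleGraph ι) :
    HasGraph M G ↔ ∀ S : Set ι, S.Finite → S.Nonempty →
      HasGraph (M.submatrix (Subtype.val : S → ι) Subtype.val) (G.induce S) := by
  constructor
  · intro h S _ _ i j hij
    exact h i j (fun hh => hij (Subtype.ext hh))
  · intro h i j hij
    exact h {i, j} (by simp) ⟨i, by simp⟩ ⟨i, by simp⟩ ⟨j, by simp⟩
      (fun hh => hij (congrArg Subtype.val hh))

/-- The approximate point spectrum of a bounded operator on `ℓ²(ℕ)`. -/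
def approxPointSpectrum (T : EllTwo →L[ℂ] EllTwo) : Set ℂ :=
  {μ | ∀ ε : ℝ, 0 < ε → ∃ v : EllTwo, ‖v‖ = 1 ∧ ‖T v - μ • v‖ < ε}

/-- `T` is a bounded self-adjoint operator on `ℓ²(ℕ)` whose spectrum and approximate point
spectrum both equal `Λ` and whose standard matrix is real symmetric with graph `G`. -/
def SolvesSISP (G : SimpleGraph ℕ) (Λ : Set ℝ) (T : EllTwo →L[ℂ] EllTwo) : Prop :=
  IsSelfAdjoint T ∧
  spectrum ℂ T = (fun x : ℝ => (x : ℂ)) '' Λ ∧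
  approxPointSpectrum T = (fun x : ℝ => (x : ℂ)) '' Λ ∧
  ∃ M : Matrix ℕ ℕ ℝ, M.IsSymm ∧ HasStandardMatrix T M ∧ HasGraph M G

/-- The real symmetric matrix `A` has graph `G` and spectrum `{lam 0, …, lam (n - 1)}`. -/
def SolvesFiniteSIEP {n : ℕ} (G : SimpleGraph (Fin n)) (lam : ℕ → ℝ)
    (A : Matrix (Fin n) (Fin n) ℝ) : Prop :=
  A.IsSymm ∧ HasGraph A G ∧ spectrum ℝ A = Set.range (fun i : Fin n => lam i)

/-- The infinite matrix `A ⊕ diag (lam n, lam (n + 1), …)`. -/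
def extendByDiagonal {n : ℕ} (A : Matrix (Fin n) (Fin n) ℝ) (lam : ℕ → ℝ) : Matrix ℕ ℕ ℝ :=
  fun i j =>
    if h : i < n ∧ j < n then A ⟨i, h.1⟩ ⟨j, h.2⟩
    else if i = j then lam i
    else 0

/-- `lam` enumerates, without repetition, a countable dense subset of `Λ`. -/
def EnumeratesDenseSubset (lam : ℕ → ℝ) (Λ : Set ℝ) : Prop :=
  Function.Injective lam ∧ Set.range lam ⊆ Λ ∧ Λ ⊆ closure (Set.range lam)

/-!
The finite matrices are built one vertex at a time by the Jacobian method. Let `A` be symmetric with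
graph `G` induced on the first `n` vertices and distinct eigenvalues `lam 0, …, lam (n - 1)`. Then
`A ⊕ (lam n)` has the right spectrum but lacks the edges at the new vertex. Switching these on with
weight `t` moves the eigenvalues, and the implicit function theorem, applied to
`(t, d) ↦ (det (lam k - A ⊕ (lam n) - t E - diag d))ₖ`, provides a small diagonal correction `d t`
that moves them back (`exists_diagonal_correction`). It needs the Jacobian in `d` to be nonsingular.
Up to sign this Jacobian is the matrix of principal cofactors of `lam k - A`, see
`cofactorJacobian`. Its nonsingularity is carried along as an invariant: it passes to `A ⊕ (lam n)`
because the Jacobian of the direct sum is block diagonal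
(`det_cofactorJacobian_extendByDiagonal_ne_zero`), and to small perturbations by continuity. The
result is `IsNondegenerateRealization.exists_extension`.

Taking the steps small enough makes the operators `S n` with matrices `A n ⊕ diag` a Cauchy
sequence, and keeps the edge entries away from zero in the limit `T` (`hasGraph_of_tendsto`). Each
`lam k` is an eigenvalue of `S n` for all `n > k`, hence an approximate eigenvalue of `T`, and the
approximate point spectrum is closed; so it contains `Λ`. Conversely, for `μ` at distance `δ` from
`Λ`, each `A n - μ` is bounded below by `δ`, and so is `T - μ`, since truncations of a vector to
the first `n` coordinates converge to it and are acted on by `S n` as by `A n`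
(`mul_norm_le_norm_sub_of_tendsto`). For self-adjoint `T` this makes `T - μ` invertible.
-/

/-! ### Prescribed eigenvalues and determinants -/

theorem Matrix.mem_spectrum_iff_det_eq_zero {m : Type*} [Fintype m] [DecidableEq m]
    (A : Matrix m m ℝ) (μ : ℝ) :
    μ ∈ spectrum ℝ A ↔ (μ • (1 : Matrix m m ℝ) - A).det = 0 := by
  rw [spectrum.mem_iff, Matrix.isUnit_iff_isUnit_det, isUnit_iff_ne_zero, not_not,
    Algebra.algebraMap_eq_smul_one]

theorem Matrix.spectrum_eq_range_of_det_eq_zero {m : Type*} [Fintype m] [DecidableEq m]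
    (A : Matrix m m ℝ) (lam : m → ℝ) (hlam : Function.Injective lam)
    (h : ∀ k, (lam k • (1 : Matrix m m ℝ) - A).det = 0) :
    spectrum ℝ A = Set.range lam := by
  classical
  have hsub : Finset.univ.image lam ⊆ A.charpoly.roots.toFinset := by
    intro x hx
    obtain ⟨k, -, rfl⟩ := Finset.mem_image.1 hx
    rw [Multiset.mem_toFinset, Polynomial.mem_roots A.charpoly_monic.ne_zero,
      ← Matrix.mem_spectrum_iff_isRoot_charpoly, Matrix.mem_spectrum_iff_det_eq_zero]
    exact h k
  -- a polynomial of degree `card m` has no roots besides `card m` known ones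
  have heq : Finset.univ.image lam = A.charpoly.roots.toFinset := by
    apply Finset.eq_of_subset_of_card_le hsub
    rw [Finset.card_image_of_injective _ hlam, Finset.card_univ]
    calc _ ≤ Multiset.card A.charpoly.roots := Multiset.toFinset_card_le _
      _ ≤ _ := Polynomial.card_roots' _
      _ = _ := A.charpoly_natDegree_eq_dim
  ext μ
  rw [Matrix.mem_spectrum_iff_isRoot_charpoly, ← Polynomial.mem_roots A.charpoly_monic.ne_zero,
    ← Multiset.mem_toFinset, ← heq]
  simp

/-! ### Correcting the eigenvalues by the diagonal -/

/-- The matrix whose `(k, i)` entry is the `i`-th principal cofactor of `lam k - A`. Up to sign it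
is the Jacobian matrix of `d ↦ (det (lam k - A - diag d))ₖ` at `d = 0`. -/
noncomputable def cofactorJacobian {m : Type*} [Fintype m] [DecidableEq m]
    (lam : m → ℝ) (A : Matrix m m ℝ) : Matrix m m ℝ :=
  Matrix.of fun k i => (lam k • (1 : Matrix m m ℝ) - A).adjugate i i

theorem Matrix.det_sub_smul_diagonal_single {m : Type*} [Fintype m] [DecidableEq m]
    (B : Matrix m m ℝ) (i : m) (s : ℝ) :
    (B - s • Matrix.diagonal (Pi.single i 1)).det = B.det - s * B.adjugate i i := by
  have h : B - s • Matrix.diagonal (Pi.single i (1 : ℝ)) =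
      B.updateRow i (B i + (-s) • Pi.single i 1) := by
    ext a b
    by_cases ha : a = i
    · subst ha
      by_cases hb : a = b
      · subst hb; simp [sub_eq_add_neg]
      · simp [hb, Ne.symm hb]
    · by_cases hb : a = b
      · subst hb; simp [ha]
      · simp [ha, hb]
  rw [h, Matrix.det_updateRow_add, Matrix.det_updateRow_smul, Matrix.updateRow_eq_self,
    Matrix.adjugate_apply]
  ring

theorem Matrix.contDiff_det {m : Type*} [Fintype m] [DecidableEq m] {E : Type*}
    [NormedAddCommGroup E] [NormedSpace ℝ E] {f : E → Matrix m m ℝ}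
    (hf : ∀ i j, ContDiff ℝ 1 fun x => f x i j) : ContDiff ℝ 1 fun x => (f x).det := by
  simp only [Matrix.det_apply']
  fun_prop

/-- If the cofactor Jacobian is nonsingular, the eigenvalues can be kept fixed along any linear
perturbation `t • E` by a diagonal correction that depends continuously on `t`. -/
theorem exists_diagonal_correction {m : Type*} [Fintype m] [DecidableEq m]
    (B E : Matrix m m ℝ) (lam : m → ℝ)
    (h0 : ∀ k, (lam k • (1 : Matrix m m ℝ) - B).det = 0)
    (hJ : (cofactorJacobian lam B).det ≠ 0) :
    ∃ d : ℝ → m → ℝ, Tendsto d (𝓝 0) (𝓝 0) ∧ ∀ᶠ t in 𝓝 (0 : ℝ), ∀ k,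
      (lam k • (1 : Matrix m m ℝ) - (B + t • E + Matrix.diagonal (d t))).det = 0 := by
  let F : ℝ × (m → ℝ) → m → ℝ := fun p k =>
    (lam k • (1 : Matrix m m ℝ) - (B + p.1 • E + Matrix.diagonal p.2)).det
  have hF : ContDiff ℝ 1 F := by
    refine contDiff_pi.2 fun k => Matrix.contDiff_det fun i j => ?_
    by_cases hij : i = j
    · subst hij
      simp only [Matrix.sub_apply, Matrix.add_apply, Matrix.smul_apply, Matrix.diagonal_apply_eq]
      fun_prop
    · simp only [Matrix.sub_apply, Matrix.add_apply, Matrix.smul_apply,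
        Matrix.diagonal_apply_ne _ hij]
      fun_prop
  have hF0 : F (0, 0) = 0 := by
    ext k
    simp [F, h0]
  have hstrict := (hF.contDiffAt (x := ((0, 0) : ℝ × (m → ℝ)))).hasStrictFDerivAt one_ne_zero
  set f' := fderiv ℝ F (0, 0) with hf'
  -- in the direction of a single diagonal entry the determinant is affine, with slope a cofactor
  have hcol : ∀ i k, f' (0, Pi.single i 1) k = -cofactorJacobian lam B k i := by
    intro i k
    have h1 : HasDerivAt (fun s : ℝ => F (0, s • Pi.single i 1)) (f' (0, Pi.single i 1)) 0 := by
      have hc : HasDerivAt (fun s : ℝ => ((0 : ℝ), s • (Pi.single i 1 : m → ℝ)))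
          ((0 : ℝ), (Pi.single i 1 : m → ℝ)) 0 := by
        have := (hasDerivAt_id (0 : ℝ)).smul_const (Pi.single i 1 : m → ℝ)
        simpa using (hasDerivAt_const (0 : ℝ) (0 : ℝ)).prodMk this
      have hd : HasFDerivAt F f' ((0 : ℝ), (0 : ℝ) • (Pi.single i 1 : m → ℝ)) := by
        rw [zero_smul]; exact hstrict.hasFDerivAt
      exact hd.comp_hasDerivAt (0 : ℝ) hc
    have h2 : (fun s : ℝ => F (0, s • Pi.single i 1) k) =
        fun s => (lam k • (1 : Matrix m m ℝ) - B).det - s * cofactorJacobian lam B k i := by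
      ext s
      have := Matrix.det_sub_smul_diagonal_single (lam k • (1 : Matrix m m ℝ) - B) i s
      simp only [F, cofactorJacobian, Matrix.of_apply, ← this]
      rw [zero_smul, add_zero, ← Matrix.diagonal_smul, sub_sub]
    have h3 := hasDerivAt_pi.1 h1 k
    rw [h2] at h3
    refine h3.unique ?_
    simpa using ((hasDerivAt_id (0 : ℝ)).mul_const (cofactorJacobian lam B k i)).const_sub
      ((lam k • (1 : Matrix m m ℝ) - B).det)
  have happ : ∀ d : m → ℝ,
      (f' ∘L .inr ℝ ℝ (m → ℝ)) d = -(cofactorJacobian lam B).mulVec d := by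
    intro d
    have : d = ∑ i, d i • (Pi.single i 1 : m → ℝ) := by
      simpa using (pi_eq_sum_univ' d)
    conv_lhs => rw [this]
    rw [map_sum]
    ext k
    simp [Matrix.mulVec, dotProduct, hcol, mul_comm]
  have hinj : Function.Injective (f' ∘L .inr ℝ ℝ (m → ℝ)) := by
    rw [injective_iff_map_eq_zero]
    intro d hd
    rw [happ, neg_eq_zero] at hd
    exact Matrix.eq_zero_of_mulVec_eq_zero hJ hd
  have hinv : (f' ∘L .inr ℝ ℝ (m → ℝ)).IsInvertible := by
    refine ⟨(LinearEquiv.ofInjectiveEndo _ hinj).toContinuousLinearEquiv, ?_⟩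
    ext1 d
    rfl
  refine ⟨hstrict.implicitFunctionOfProdDomain hinv,
    hstrict.tendsto_implicitFunctionOfProdDomain hinv, ?_⟩
  filter_upwards [hstrict.eventually_apply_implicitFunctionOfProdDomain hinv] with t ht k
  rw [hF0] at ht
  exact congrFun ht k

/-! ### Adding a vertex to the graph -/

theorem Matrix.adjugate_fromBlocks_inl {m n : Type*} [Fintype m] [DecidableEq m] [Fintype n]
    [DecidableEq n] (A : Matrix m m ℝ) (D : Matrix n n ℝ) (i : m) :
    (Matrix.fromBlocks A 0 0 D).adjugate (Sum.inl i) (Sum.inl i) = A.adjugate i i * D.det := by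
  rw [Matrix.adjugate_apply, Matrix.adjugate_apply, ← Matrix.det_fromBlocks_zero₂₁ _ 0 D]
  congr 1
  ext (a | a) (b | b) <;> simp [Matrix.updateRow_apply, Pi.single_apply]

theorem Matrix.adjugate_fromBlocks_inr {m n : Type*} [Fintype m] [DecidableEq m] [Fintype n]
    [DecidableEq n] (A : Matrix m m ℝ) (D : Matrix n n ℝ) (i : n) :
    (Matrix.fromBlocks A 0 0 D).adjugate (Sum.inr i) (Sum.inr i) = A.det * D.adjugate i i := by
  rw [Matrix.adjugate_apply, Matrix.adjugate_apply, ← Matrix.det_fromBlocks_zero₂₁ A 0]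
  congr 1
  ext (a | a) (b | b) <;> simp [Matrix.updateRow_apply, Pi.single_apply]

theorem smul_one_sub_extendByDiagonal {n : ℕ} (A : Matrix (Fin n) (Fin n) ℝ) (lam : ℕ → ℝ)
    (μ : ℝ) :
    μ • (1 : Matrix (Fin (n + 1)) (Fin (n + 1)) ℝ) -
        Matrix.of (fun i j : Fin (n + 1) => extendByDiagonal A lam i j) =
      Matrix.reindex finSumFinEquiv finSumFinEquiv
        (Matrix.fromBlocks (μ • (1 : Matrix (Fin n) (Fin n) ℝ) - A) 0 0
          ((μ - lam n) • (1 : Matrix (Fin 1) (Fin 1) ℝ))) := by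
  ext i j
  obtain ⟨i, rfl⟩ := finSumFinEquiv.surjective i
  obtain ⟨j, rfl⟩ := finSumFinEquiv.surjective j
  rcases i with i | i <;> rcases j with j | j
  · simp [extendByDiagonal, Matrix.one_apply]
  · have h1 : (i : ℕ) ≠ n := i.2.ne
    have h2 : Fin.castAdd 1 i ≠ Fin.natAdd n j := by
      intro h; have := congrArg Fin.val h; simp at this; omega
    simp [extendByDiagonal, h1, h2]
  · have h1 : n ≠ (j : ℕ) := j.2.ne'
    have h2 : Fin.natAdd n i ≠ Fin.castAdd 1 j := by
      intro h; have := congrArg Fin.val h; simp at this; omega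
    simp [extendByDiagonal, h1, h2]
  · obtain rfl : i = j := Subsingleton.elim _ _
    simp [extendByDiagonal]

theorem det_smul_one_sub_extendByDiagonal {n : ℕ} (A : Matrix (Fin n) (Fin n) ℝ) (lam : ℕ → ℝ)
    (h0 : ∀ k : Fin n, (lam k • (1 : Matrix (Fin n) (Fin n) ℝ) - A).det = 0) (k : Fin (n + 1)) :
    (lam k • (1 : Matrix (Fin (n + 1)) (Fin (n + 1)) ℝ) -
        Matrix.of (fun i j : Fin (n + 1) => extendByDiagonal A lam i j)).det = 0 := by
  rw [smul_one_sub_extendByDiagonal, Matrix.det_reindex_self, Matrix.det_fromBlocks_zero₂₁]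
  refine Fin.lastCases ?_ (fun k => ?_) k
  · simp
  · simp only [Fin.val_castSucc, h0 k, zero_mul]

/-- Adjoining the new eigenvalue `lam n` as a direct summand multiplies the determinant of the
cofactor Jacobian by `∏ₖ (lam k - lam n)` and by `det (lam n - A)`. -/
theorem det_cofactorJacobian_extendByDiagonal_ne_zero {n : ℕ} (A : Matrix (Fin n) (Fin n) ℝ)
    (lam : ℕ → ℝ) (hlam : Function.Injective lam)
    (h0 : ∀ k : Fin n, (lam k • (1 : Matrix (Fin n) (Fin n) ℝ) - A).det = 0)
    (hJ : (cofactorJacobian (fun k : Fin n => lam k) A).det ≠ 0) :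
    (cofactorJacobian (fun k : Fin (n + 1) => lam k)
      (Matrix.of fun i j : Fin (n + 1) => extendByDiagonal A lam i j)).det ≠ 0 := by
  have hblock : cofactorJacobian (fun k : Fin (n + 1) => lam k)
      (Matrix.of fun i j : Fin (n + 1) => extendByDiagonal A lam i j) =
      Matrix.reindex finSumFinEquiv finSumFinEquiv
        (Matrix.fromBlocks
          (Matrix.diagonal (fun k : Fin n => lam k - lam n) *
            cofactorJacobian (fun k : Fin n => lam k) A) 0 0
          ((lam n • (1 : Matrix (Fin n) (Fin n) ℝ) - A).det •
            (1 : Matrix (Fin 1) (Fin 1) ℝ))) := by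
    ext k i
    obtain ⟨k, rfl⟩ := finSumFinEquiv.surjective k
    obtain ⟨i, rfl⟩ := finSumFinEquiv.surjective i
    have hentry : ∀ (M : Matrix (Fin n ⊕ Fin 1) (Fin n ⊕ Fin 1) ℝ) (x : Fin n ⊕ Fin 1),
        (Matrix.reindex finSumFinEquiv finSumFinEquiv M).adjugate (finSumFinEquiv x)
          (finSumFinEquiv x) = M.adjugate x x := by
      intro M x
      rw [Matrix.adjugate_reindex]
      simp
    simp only [cofactorJacobian, Matrix.of_apply, smul_one_sub_extendByDiagonal, hentry]
    simp only [Matrix.reindex_apply, Matrix.submatrix_apply, Equiv.symm_apply_apply]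
    rcases i with i | i
    · rw [Matrix.adjugate_fromBlocks_inl]
      rcases k with k | k
      · simp [mul_comm]
      · simp
    · rw [Matrix.adjugate_fromBlocks_inr]
      rcases k with k | k
      · simp [h0]
      · obtain rfl : k = i := Subsingleton.elim _ _
        simp
  -- `lam n` differs from the eigenvalues `lam 0, …, lam (n - 1)` of `A`
  have hnot : (lam n • (1 : Matrix (Fin n) (Fin n) ℝ) - A).det ≠ 0 := by
    rw [Ne, ← Matrix.mem_spectrum_iff_det_eq_zero,
      Matrix.spectrum_eq_range_of_det_eq_zero A (fun k : Fin n => lam k)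
        (hlam.comp Fin.val_injective) h0]
    rintro ⟨k, hk⟩
    exact k.2.ne (hlam hk)
  rw [hblock, Matrix.det_reindex_self, Matrix.det_fromBlocks_zero₂₁, Matrix.det_mul,
    Matrix.det_diagonal]
  refine mul_ne_zero (mul_ne_zero (Finset.prod_ne_zero_iff.2 fun k _ => ?_) hJ) (by simpa using hnot)
  exact sub_ne_zero.2 fun h => k.2.ne (hlam h)

/-- `A` is a symmetric matrix with graph `G` that has `lam` as eigenvalues, and the diagonal
perturbations of `A` move these eigenvalues independently to first order. -/
structure IsNondegenerateRealization {n : ℕ} (G : SimpleGraph (Fin n)) (lam : ℕ → ℝ)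
    (A : Matrix (Fin n) (Fin n) ℝ) : Prop where
  isSymm : A.IsSymm
  hasGraph : HasGraph A G
  det_eq_zero : ∀ k : Fin n, (lam k • (1 : Matrix (Fin n) (Fin n) ℝ) - A).det = 0
  det_jacobian_ne_zero : (cofactorJacobian (fun k : Fin n => lam k) A).det ≠ 0

theorem IsNondegenerateRealization.solvesFiniteSIEP {n : ℕ} {G : SimpleGraph (Fin n)}
    {lam : ℕ → ℝ} {A : Matrix (Fin n) (Fin n) ℝ} (h : IsNondegenerateRealization G lam A)
    (hlam : Function.Injective lam) : SolvesFiniteSIEP G lam A :=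
  ⟨h.isSymm, h.hasGraph, Matrix.spectrum_eq_range_of_det_eq_zero A (fun k : Fin n => lam k)
    (hlam.comp Fin.val_injective) h.det_eq_zero⟩

theorem extendByDiagonal_isSymm {n : ℕ} {A : Matrix (Fin n) (Fin n) ℝ} (hA : A.IsSymm)
    (lam : ℕ → ℝ) : (extendByDiagonal A lam).IsSymm := by
  ext i j
  simp only [Matrix.transpose_apply, extendByDiagonal]
  by_cases h : i < n ∧ j < n
  · rw [dif_pos h, dif_pos h.symm]
    exact hA.apply _ _
  · rw [dif_neg h, dif_neg (fun h' => h h'.symm)]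
    by_cases hij : i = j
    · subst hij; simp
    · simp [hij, Ne.symm hij]

/-- One vertex can be added to the graph, at an arbitrarily small cost in every entry. -/
theorem IsNondegenerateRealization.exists_extension {n : ℕ} {G : SimpleGraph (Fin (n + 1))}
    {lam : ℕ → ℝ} {A : Matrix (Fin n) (Fin n) ℝ} (hlam : Function.Injective lam)
    (h : IsNondegenerateRealization (G.comap Fin.castSucc) lam A) {ε : ℝ} (hε : 0 < ε) :
    ∃ A' : Matrix (Fin (n + 1)) (Fin (n + 1)) ℝ, IsNondegenerateRealization G lam A' ∧
      ∑ i, ∑ j, |A' i j - extendByDiagonal A lam i j| < ε := by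
  classical
  set B : Matrix (Fin (n + 1)) (Fin (n + 1)) ℝ :=
    Matrix.of fun i j : Fin (n + 1) => extendByDiagonal A lam i j with hB
  -- the edges that join the new vertex to the old ones
  let E : Matrix (Fin (n + 1)) (Fin (n + 1)) ℝ := Matrix.of fun i j =>
    if G.Adj i j ∧ (i = Fin.last n ∨ j = Fin.last n) then 1 else 0
  obtain ⟨d, hd, hdet⟩ := exists_diagonal_correction B E (fun k : Fin (n + 1) => lam k)
    (det_smul_one_sub_extendByDiagonal A lam h.det_eq_zero)
    (det_cofactorJacobian_extendByDiagonal_ne_zero A lam hlam h.det_eq_zero h.det_jacobian_ne_zero)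
  let C : ℝ → Matrix (Fin (n + 1)) (Fin (n + 1)) ℝ := fun t => B + t • E + Matrix.diagonal (d t)
  have hC : Tendsto C (𝓝 0) (𝓝 B) := by
    have h1 : Tendsto (fun t : ℝ => t • E) (𝓝 0) (𝓝 ((0 : ℝ) • E)) :=
      tendsto_id.smul tendsto_const_nhds
    have h2 : Tendsto (fun t => Matrix.diagonal (d t)) (𝓝 0)
        (𝓝 (Matrix.diagonal (0 : Fin (n + 1) → ℝ))) :=
      ((continuous_id.matrix_diagonal).tendsto (0 : Fin (n + 1) → ℝ)).comp hd
    simpa using (tendsto_const_nhds.add h1).add h2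
  have hsmall : ∀ᶠ t in 𝓝 (0 : ℝ), ∑ i, ∑ j, |C t i j - B i j| < ε := by
    have hcont : Continuous fun M : Matrix (Fin (n + 1)) (Fin (n + 1)) ℝ =>
        ∑ i, ∑ j, |M i j - B i j| := by fun_prop
    have := (hcont.tendsto B).comp hC
    simp only [sub_self, abs_zero, Finset.sum_const_zero] at this
    exact this.eventually_lt_const hε
  have hJ : ∀ᶠ t in 𝓝 (0 : ℝ), (cofactorJacobian (fun k : Fin (n + 1) => lam k) (C t)).det ≠ 0 := by
    have hcont : Continuous fun M : Matrix (Fin (n + 1)) (Fin (n + 1)) ℝ =>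
        (cofactorJacobian (fun k : Fin (n + 1) => lam k) M).det := by
      refine Continuous.matrix_det (continuous_matrix fun k i => ?_)
      simp only [cofactorJacobian, Matrix.of_apply]
      exact (Continuous.matrix_adjugate (by fun_prop)).matrix_elem i i
    exact ((hcont.tendsto B).comp hC).eventually_ne
      (det_cofactorJacobian_extendByDiagonal_ne_zero A lam hlam h.det_eq_zero
        h.det_jacobian_ne_zero)
  obtain ⟨t, ⟨hdet, hsmall, hJ⟩, ht⟩ :=
    ((((hdet.and (hsmall.and hJ)).filter_mono nhdsWithin_le_nhds).and
      (self_mem_nhdsWithin : {(0 : ℝ)}ᶜ ∈ 𝓝[≠] (0 : ℝ)))).exists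
  refine ⟨C t, ⟨?_, ?_, hdet, hJ⟩, hsmall⟩
  · have hE : E.IsSymm := by
      ext i j
      simp only [E, Matrix.transpose_apply, Matrix.of_apply, G.adj_comm j i, or_comm]
    have hBs : B.IsSymm := by
      ext i j
      exact (extendByDiagonal_isSymm h.isSymm lam).apply _ _
    exact (hBs.add (hE.smul t)).add (Matrix.isSymm_diagonal _)
  · intro i j hij
    simp only [C, Matrix.add_apply, Matrix.smul_apply, Matrix.diagonal_apply_ne _ hij, add_zero]
    have ht' : t ≠ 0 := ht
    by_cases hl : i = Fin.last n ∨ j = Fin.last n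
    · have hb : B i j = 0 := by
        have h1 : ¬ ((i : ℕ) < n ∧ (j : ℕ) < n) := by
          rcases hl with rfl | rfl <;> simp
        simp [hB, extendByDiagonal, h1, Fin.val_inj, hij]
      by_cases hadj : G.Adj i j <;> simp [hb, E, hl, hadj, ht']
    · push Not at hl
      obtain ⟨i, rfl⟩ := Fin.exists_castSucc_eq.2 hl.1
      obtain ⟨j, rfl⟩ := Fin.exists_castSucc_eq.2 hl.2
      have := h.hasGraph i j (fun h => hij (congrArg _ h))
      simpa [E, hB, extendByDiagonal, Fin.castSucc_ne_last] using this

/-! ### Operators on `ℓ²(ℕ)` and their standard matrices -/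

theorem stdVec_apply (j i : ℕ) : (stdVec j : ℕ → ℂ) i = if i = j then 1 else 0 := by
  simp [stdVec, Pi.single_apply]

theorem norm_stdVec (j : ℕ) : ‖stdVec j‖ = 1 := by
  rw [stdVec, lp.norm_single (by norm_num), norm_one]

theorem inner_stdVec_left (j : ℕ) (v : EllTwo) : inner ℂ (stdVec j) v = v j := by
  rw [stdVec, lp.inner_single_left]
  simp

theorem single_eq_smul_stdVec (j : ℕ) (a : ℂ) :
    lp.single (E := fun _ : ℕ => ℂ) 2 j a = a • stdVec j := by
  rw [stdVec, ← lp.single_smul, smul_eq_mul, mul_one]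

theorem hasSum_smul_stdVec (v : EllTwo) : HasSum (fun i => v i • stdVec i) v := by
  simpa only [single_eq_smul_stdVec] using lp.hasSum_single (p := 2) (by norm_num) v

theorem continuousLinearMap_ext_stdVec {T T' : EllTwo →L[ℂ] EllTwo}
    (h : ∀ j, T (stdVec j) = T' (stdVec j)) : T = T' := by
  ext1 v
  refine ((hasSum_smul_stdVec v).mapL T).unique ?_
  simpa only [map_smul, h] using (hasSum_smul_stdVec v).mapL T'

/-- A bounded operator is determined by its standard matrix. -/
theorem HasStandardMatrix.ext {T T' : EllTwo →L[ℂ] EllTwo} {M : Matrix ℕ ℕ ℝ}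
    (h : HasStandardMatrix T M) (h' : HasStandardMatrix T' M) : T = T' :=
  continuousLinearMap_ext_stdVec fun j => lp.ext (funext fun i => (h i j).trans (h' i j).symm)

theorem HasStandardMatrix.isSelfAdjoint {T : EllTwo →L[ℂ] EllTwo} {M : Matrix ℕ ℕ ℝ}
    (h : HasStandardMatrix T M) (hM : M.IsSymm) : IsSelfAdjoint T := by
  rw [ContinuousLinearMap.isSelfAdjoint_iff']
  refine HasStandardMatrix.ext (M := M) (fun i j => ?_) h
  rw [← inner_stdVec_left, ContinuousLinearMap.adjoint_inner_right, ← inner_conj_symm,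
    inner_stdVec_left, h j i, Complex.conj_ofReal, hM.apply]

theorem HasStandardMatrix.add {T T' : EllTwo →L[ℂ] EllTwo} {M M' : Matrix ℕ ℕ ℝ}
    (h : HasStandardMatrix T M) (h' : HasStandardMatrix T' M') :
    HasStandardMatrix (T + T') (M + M') := by
  intro i j
  simp [h i j, h' i j]

theorem HasStandardMatrix.sub {T T' : EllTwo →L[ℂ] EllTwo} {M M' : Matrix ℕ ℕ ℝ}
    (h : HasStandardMatrix T M) (h' : HasStandardMatrix T' M') :
    HasStandardMatrix (T - T') (M - M') := by
  intro i j
  simp [h i j, h' i j]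

theorem exists_hasStandardMatrix_diagonal (c : ℕ → ℝ) {K : ℝ} (hK : ∀ i, |c i| ≤ K) :
    ∃ D : EllTwo →L[ℂ] EllTwo, HasStandardMatrix D (Matrix.diagonal c) := by
  have hK0 : 0 ≤ K := (abs_nonneg _).trans (hK 0)
  have hle : ∀ (v : EllTwo) i, ‖(c i : ℂ) * v i‖ ^ 2 ≤ K ^ 2 * ‖v i‖ ^ 2 := by
    intro v i
    rw [norm_mul, Complex.norm_real, Real.norm_eq_abs, mul_pow]
    gcongr
    exact hK i
  have hsum : ∀ v : EllTwo, Summable fun i => ‖v i‖ ^ 2 := by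
    intro v
    simpa using (lp.memℓp v).summable (by norm_num)
  have hsum' : ∀ v : EllTwo, Summable fun i => ‖(c i : ℂ) * v i‖ ^ 2 := fun v =>
    Summable.of_nonneg_of_le (fun _ => by positivity) (hle v) ((hsum v).mul_left _)
  have hmem : ∀ v : EllTwo, Memℓp (fun i => (c i : ℂ) * v i) 2 := by
    intro v
    refine memℓp_gen ?_
    simpa using hsum' v
  let f : EllTwo →ₗ[ℂ] EllTwo :=
    { toFun := fun v => ⟨fun i => (c i : ℂ) * v i, hmem v⟩
      map_add' := fun v w => lp.ext (funext fun i => mul_add _ _ _)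
      map_smul' := fun a v => lp.ext (funext fun i => mul_left_comm _ _ _) }
  have hnorm : ∀ v : EllTwo, ‖v‖ ^ 2 = ∑' i, ‖v i‖ ^ 2 := by
    intro v
    simpa using lp.norm_rpow_eq_tsum (p := 2) (by norm_num) v
  refine ⟨f.mkContinuous K fun v => ?_, fun i j => ?_⟩
  · refine le_of_sq_le_sq ?_ (by positivity)
    rw [mul_pow, hnorm, hnorm, ← tsum_mul_left]
    exact (hsum' v).tsum_le_tsum (hle v) ((hsum v).mul_left _)
  · change (c i : ℂ) * (stdVec j : ℕ → ℂ) i = _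
    rw [stdVec_apply, Matrix.diagonal_apply]
    split_ifs <;> simp

/-- A real matrix supported on the leading `n × n` block defines an operator whose norm is at most
the sum of the absolute values of the entries. -/
theorem exists_hasStandardMatrix_of_finite_support (n : ℕ) (C : Matrix ℕ ℕ ℝ)
    (hC : ∀ i j, ¬ (i < n ∧ j < n) → C i j = 0) :
    ∃ T : EllTwo →L[ℂ] EllTwo, HasStandardMatrix T C ∧
      ‖T‖ ≤ ∑ i : Fin n, ∑ j : Fin n, |C i j| := by
  refine ⟨∑ i : Fin n, ∑ j : Fin n,
    (C i j : ℂ) • (innerSL ℂ (stdVec j)).smulRight (stdVec i), fun a b => ?_, ?_⟩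
  · simp only [sum_apply, smul_apply,
      ContinuousLinearMap.smulRight_apply, innerSL_apply_apply, inner_stdVec_left, lp.coeFn_sum,
      Finset.sum_apply, lp.coeFn_smul, Pi.smul_apply, smul_eq_mul, stdVec_apply]
    by_cases hab : a < n ∧ b < n
    · rw [Finset.sum_eq_single ⟨a, hab.1⟩, Finset.sum_eq_single ⟨b, hab.2⟩]
      · simp
      · intro j _ hj
        rw [if_neg (fun h => hj (Fin.ext h))]
        simp
      · simp
      · intro i _ hi
        refine Finset.sum_eq_zero fun j _ => ?_
        rw [if_neg (c := a = (i : ℕ)) (fun h => hi (Fin.ext h.symm)), mul_zero, mul_zero]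
      · simp
    · rw [hC a b hab, Complex.ofReal_zero]
      refine Finset.sum_eq_zero fun i _ => Finset.sum_eq_zero fun j _ => ?_
      by_cases h1 : (j : ℕ) = b
      · by_cases h2 : a = (i : ℕ)
        · exact absurd ⟨h2 ▸ i.2, h1 ▸ j.2⟩ hab
        · simp [h2]
      · simp [h1]
  · refine (norm_sum_le _ _).trans (Finset.sum_le_sum fun i _ => ?_)
    refine (norm_sum_le _ _).trans (Finset.sum_le_sum fun j _ => ?_)
    rw [norm_smul, ContinuousLinearMap.norm_smulRight_apply, innerSL_apply_norm, norm_stdVec,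
      norm_stdVec, Complex.norm_real, Real.norm_eq_abs, mul_one, mul_one]

/-! ### Finite sections -/

/-- The inclusion of `ℂⁿ` into `ℓ²(ℕ)` as the first `n` coordinates. -/
noncomputable def includeFin {n : ℕ} (x : EuclideanSpace ℂ (Fin n)) : EllTwo :=
  ∑ i, x i • stdVec i

theorem norm_includeFin {n : ℕ} (x : EuclideanSpace ℂ (Fin n)) : ‖includeFin x‖ = ‖x‖ := by
  have h : Orthonormal ℂ fun i : Fin n => stdVec i := by
    rw [orthonormal_iff_ite]
    intro i j
    rw [inner_stdVec_left, stdVec_apply]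
    simp [Fin.ext_iff]
  rw [← sq_eq_sq₀ (norm_nonneg _) (norm_nonneg _), EuclideanSpace.norm_sq_eq, includeFin,
    ← Complex.ofReal_inj, Complex.ofReal_pow]
  refine (inner_self_eq_norm_sq_to_K (𝕜 := ℂ) (E := EllTwo) _).symm.trans ?_
  rw [h.inner_sum]
  simp [Complex.conj_mul']

theorem includeFin_smul {n : ℕ} (a : ℂ) (x : EuclideanSpace ℂ (Fin n)) :
    includeFin (a • x) = a • includeFin x := by
  simp [includeFin, Finset.smul_sum, mul_smul]

theorem includeFin_sub {n : ℕ} (x y : EuclideanSpace ℂ (Fin n)) :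
    includeFin (x - y) = includeFin x - includeFin y := by
  simp [includeFin, sub_smul]

theorem tendsto_includeFin (v : EllTwo) :
    Tendsto (fun n => includeFin (WithLp.toLp 2 fun i : Fin n => v i)) atTop (𝓝 v) := by
  have := (hasSum_smul_stdVec v).tendsto_sum_nat
  simpa only [includeFin, Fin.sum_univ_eq_sum_range (fun i => v i • stdVec i)] using this

/-- An operator with matrix `A ⊕ diag` acts on the first `n` coordinates as `A`. -/
theorem HasStandardMatrix.apply_includeFin {n : ℕ} {S : EllTwo →L[ℂ] EllTwo}
    {A : Matrix (Fin n) (Fin n) ℝ} {lam : ℕ → ℝ}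
    (hS : HasStandardMatrix S (extendByDiagonal A lam)) (x : EuclideanSpace ℂ (Fin n)) :
    S (includeFin x) = includeFin (Matrix.toEuclideanLin (A.map Complex.ofReal) x) := by
  refine lp.ext (funext fun a => ?_)
  simp only [includeFin, map_sum, map_smul, lp.coeFn_sum, Finset.sum_apply, lp.coeFn_smul,
    Pi.smul_apply, hS a, stdVec_apply, smul_eq_mul]
  by_cases ha : a < n
  · rw [Finset.sum_eq_single (⟨a, ha⟩ : Fin n) (f := fun i : Fin n =>
      (Matrix.toEuclideanLin (A.map Complex.ofReal) x) i * if a = (i : ℕ) then 1 else 0)]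
    · simp [extendByDiagonal, ha, Matrix.toLpLin_apply, Matrix.mulVec, dotProduct, mul_comm (x.ofLp _)]
    · intro i _ hi
      rw [if_neg (fun h => hi (Fin.ext h.symm)), mul_zero]
    · simp
  · rw [Finset.sum_eq_zero, Finset.sum_eq_zero]
    · intro i _
      have : a ≠ (i : ℕ) := fun h => ha (h ▸ i.2)
      rw [if_neg this, mul_zero]
    · intro i _
      have : a ≠ (i : ℕ) := fun h => ha (h ▸ i.2)
      simp [extendByDiagonal, ha, this]

/-- The distance from `μ` to the spectrum of a real symmetric matrix `A` is a lower bound for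
`A - μ`. -/
theorem Matrix.IsSymm.mul_norm_le_norm_toEuclideanLin_sub {n : Type*} [Fintype n] [DecidableEq n]
    {A : Matrix n n ℝ} (hA : A.IsSymm) (μ : ℂ) {δ : ℝ} (hδ : 0 ≤ δ)
    (h : ∀ s ∈ spectrum ℝ A, δ ≤ ‖(s : ℂ) - μ‖) (x : EuclideanSpace ℂ n) :
    δ * ‖x‖ ≤ ‖Matrix.toEuclideanLin (A.map Complex.ofReal) x - μ • x‖ := by
  have hH : (A.map Complex.ofReal).IsHermitian := by
    ext i j
    simp [hA.apply i j]
  -- the eigenvalues of the complexified matrix are those of `A`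
  have hmem : ∀ i, δ ≤ ‖(hH.eigenvalues i : ℂ) - μ‖ := by
    intro i
    refine h _ ?_
    have h1 := hH.eigenvalues_mem_spectrum_real i
    rw [spectrum.mem_iff, Matrix.isUnit_iff_isUnit_det, isUnit_iff_ne_zero, not_not] at h1
    rw [Matrix.mem_spectrum_iff_det_eq_zero, ← Complex.ofReal_inj, Complex.ofReal_zero, ← h1,
      ← Complex.ofRealHom_eq_coe, RingHom.map_det]
    congr 1
    ext a b
    by_cases hab : a = b
    · subst hab; simp [Matrix.algebraMap_matrix_apply]
    · simp [Matrix.algebraMap_matrix_apply, hab]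
  set b := hH.eigenvectorBasis
  have hsymm := (Matrix.isSymmetric_toEuclideanLin_iff (A := A.map Complex.ofReal)).2 hH
  have heig : ∀ i, Matrix.toEuclideanLin (A.map Complex.ofReal) (b i) =
      (hH.eigenvalues i : ℂ) • b i := by
    intro i
    rw [Matrix.toLpLin_apply, hH.mulVec_eigenvectorBasis]
    rfl
  have hcoord : ∀ i, inner ℂ (b i) (Matrix.toEuclideanLin (A.map Complex.ofReal) x - μ • x) =
      ((hH.eigenvalues i : ℂ) - μ) * inner ℂ (b i) x := by
    intro i
    rw [inner_sub_right, ← hsymm, heig, inner_smul_left, inner_smul_right, Complex.conj_ofReal,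
      sub_mul]
  refine le_of_sq_le_sq ?_ (norm_nonneg _)
  rw [mul_pow, ← b.sum_sq_norm_inner_right, ← b.sum_sq_norm_inner_right, Finset.mul_sum]
  refine Finset.sum_le_sum fun i _ => ?_
  rw [hcoord, norm_mul, mul_pow]
  gcongr
  exact hmem i

/-! ### Approximate point spectrum and spectrum -/

theorem isClosed_approxPointSpectrum (T : EllTwo →L[ℂ] EllTwo) :
    IsClosed (approxPointSpectrum T) := by
  refine isClosed_of_closure_subset fun μ hμ ε hε => ?_
  obtain ⟨ν, hν, hd⟩ := Metric.mem_closure_iff.1 hμ (ε / 2) (half_pos hε)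
  obtain ⟨v, hv, hT⟩ := hν (ε / 2) (half_pos hε)
  refine ⟨v, hv, ?_⟩
  calc ‖T v - μ • v‖ = ‖(T v - ν • v) + (ν - μ) • v‖ := by rw [sub_smul]; congr 1; abel
    _ ≤ ‖T v - ν • v‖ + ‖(ν - μ) • v‖ := norm_add_le _ _
    _ < ε / 2 + ε / 2 := by
      rw [norm_smul, hv, mul_one]
      exact add_lt_add hT (by rwa [dist_comm, dist_eq_norm] at hd)
    _ = ε := add_halves ε

theorem approxPointSpectrum_subset_spectrum (T : EllTwo →L[ℂ] EllTwo) :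
    approxPointSpectrum T ⊆ spectrum ℂ T := by
  intro μ hμ hunit
  obtain ⟨u, hu⟩ := hunit
  set R : EllTwo →L[ℂ] EllTwo := ↑u⁻¹ with hR
  obtain ⟨v, hv, hT⟩ := hμ (‖R‖ + 1)⁻¹ (by positivity)
  have h1 : R (algebraMap ℂ (EllTwo →L[ℂ] EllTwo) μ v - T v) = v := by
    have : (R * (u : EllTwo →L[ℂ] EllTwo)) v = v := by rw [hR, Units.inv_mul]; rfl
    rw [hu] at this
    exact this
  have h2 : ‖algebraMap ℂ (EllTwo →L[ℂ] EllTwo) μ v - T v‖ < (‖R‖ + 1)⁻¹ := by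
    rw [norm_sub_rev, ContinuousLinearMap.algebraMap_apply]
    exact hT
  have h3 := R.le_opNorm (algebraMap ℂ (EllTwo →L[ℂ] EllTwo) μ v - T v)
  rw [h1, hv] at h3
  have h4 : ‖R‖ * (‖R‖ + 1)⁻¹ < 1 := by
    rw [← div_eq_mul_inv, div_lt_one (by positivity)]
    linarith
  have h5 := mul_le_mul_of_nonneg_left h2.le (norm_nonneg R)
  linarith

/-- A self-adjoint operator `T` is invertible at a real point `x` where `T - x` is bounded below: the
orthogonal complement of the range is the kernel of the same operator. -/
theorem IsSelfAdjoint.notMem_spectrum_of_mul_norm_le {T : EllTwo →L[ℂ] EllTwo}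
    (hT : IsSelfAdjoint T) (x : ℝ) {δ : ℝ} (hδ : 0 < δ)
    (h : ∀ v, δ * ‖v‖ ≤ ‖T v - (x : ℂ) • v‖) : (x : ℂ) ∉ spectrum ℂ T := by
  rw [spectrum.notMem_iff, IsUnit.sub_iff]
  have happ : ∀ v, (T - algebraMap ℂ (EllTwo →L[ℂ] EllTwo) x) v = T v - (x : ℂ) • v := by
    intro v
    rw [sub_apply, ContinuousLinearMap.algebraMap_apply]
  rw [ContinuousLinearMap.isUnit_iff_bijective,
    ContinuousLinearMap.bijective_iff_dense_range_and_antilipschitz]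
  refine ⟨?_, Real.toNNReal δ⁻¹, ContinuousLinearMap.antilipschitz_of_bound _ fun v => ?_⟩
  · have hadj : IsSelfAdjoint (T - algebraMap ℂ (EllTwo →L[ℂ] EllTwo) x) :=
      hT.sub (IsSelfAdjoint.algebraMap _ (Complex.conj_ofReal x))
    rw [Submodule.topologicalClosure_eq_top_iff, ContinuousLinearMap.orthogonal_range,
      hadj.adjoint_eq, LinearMap.ker_eq_bot']
    intro v hv
    have h1 := h v
    rw [← happ] at h1
    have h2 : (T - algebraMap ℂ (EllTwo →L[ℂ] EllTwo) x) v = 0 := hv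
    rw [h2, norm_zero] at h1
    exact norm_le_zero_iff.1 (nonpos_of_mul_nonpos_right h1 hδ)
  · rw [happ, Real.coe_toNNReal _ (by positivity), inv_mul_eq_div, le_div_iff₀ hδ, mul_comm]
    exact h v

/-! ### Choice of the eigenvalues and of the finite matrices -/

theorem exists_enumeratesDenseSubset {Λ : Set ℝ} (hΛ : Λ.Infinite) :
    ∃ lam : ℕ → ℝ, EnumeratesDenseSubset lam Λ := by
  obtain ⟨c, hcsub, hccount, hcdense⟩ := TopologicalSpace.IsSeparable.exists_countable_dense_subset
    (TopologicalSpace.IsSeparable.of_separableSpace Λ)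
  have hcinf : c.Infinite := fun hfin =>
    hΛ (hfin.subset (by rwa [hfin.isClosed.closure_eq] at hcdense))
  have := hccount.to_subtype
  have := hcinf.to_subtype
  obtain ⟨f⟩ : Nonempty (ℕ ≃ c) := inferInstance
  have hrange : Set.range (fun n => (f n : ℝ)) = c := by
    rw [← Function.comp_def Subtype.val f, f.surjective.range_comp, Subtype.range_coe]
  exact ⟨fun n => f n, Subtype.val_injective.comp f.injective, hrange.symm ▸ hcsub,
    hrange.symm ▸ hcdense⟩

theorem HasGraph.exists_pos_mul_le_abs {n : ℕ} {A : Matrix (Fin n) (Fin n) ℝ}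
    {G : SimpleGraph (Fin n)} (hA : HasGraph A G) {c : ℝ} (hc : 0 < c) :
    ∃ ε, 0 < ε ∧ ε ≤ c ∧ ∀ i j, G.Adj i j → 4 * ε ≤ |A i j| := by
  have h : ∀ i j, ∀ᶠ ε in 𝓝[>] (0 : ℝ), G.Adj i j → 4 * ε ≤ |A i j| := by
    intro i j
    by_cases hij : G.Adj i j
    · have hpos : 0 < |A i j| := abs_pos.2 ((hA i j hij.ne).2 hij)
      filter_upwards [Ioo_mem_nhdsGT (show 0 < |A i j| / 4 by positivity)] with ε hε _
      have := hε.2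
      linarith
    · simp [hij]
  have hIoc : ∀ᶠ ε in 𝓝[>] (0 : ℝ), ε ∈ Set.Ioc 0 c := Ioc_mem_nhdsGT hc
  obtain ⟨ε, ⟨hε, hεc⟩, hA⟩ := (hIoc.and
    (eventually_all.2 fun i => eventually_all.2 (h i))).exists
  exact ⟨ε, hε, hεc, hA⟩

/-- A sequence of finite realizations of the leading induced subgraphs, together with the
tolerances `ε n` for the steps. The tolerances are at least halved at each step, so that all the
steps from the `n`-th on together change an entry by at most `2 * ε n`, which is at most half of
any nonzero off-diagonal entry of the `n`-th matrix. -/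
theorem exists_seq_isNondegenerateRealization (G : SimpleGraph ℕ) {lam : ℕ → ℝ}
    (hlam : Function.Injective lam) :
    ∃ (A : (n : ℕ) → Matrix (Fin n) (Fin n) ℝ) (ε : ℕ → ℝ),
      (∀ n, IsNondegenerateRealization (G.comap (Fin.val : Fin n → ℕ)) lam (A n)) ∧
      (∀ n, 0 < ε n) ∧ ε 0 ≤ 1 ∧ (∀ n, ε (n + 1) ≤ ε n / 2) ∧
      (∀ n (i j : Fin n), G.Adj i j → 4 * ε n ≤ |A n i j|) ∧
      ∀ n, ∑ i, ∑ j, |A (n + 1) i j - extendByDiagonal (A n) lam i j| < ε n := by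
  let P : (n : ℕ) → Matrix (Fin n) (Fin n) ℝ × ℝ → Prop := fun n p =>
    IsNondegenerateRealization (G.comap (Fin.val : Fin n → ℕ)) lam p.1 ∧ 0 < p.2 ∧
      ∀ i j : Fin n, G.Adj i j → 4 * p.2 ≤ |p.1 i j|
  have hstep : ∀ (n : ℕ) (p : {p // P n p}), ∃ q : {q // P (n + 1) q},
      q.1.2 ≤ p.1.2 / 2 ∧
      ∑ i, ∑ j, |q.1.1 i j - extendByDiagonal p.1.1 lam i j| < p.1.2 := by
    rintro n ⟨⟨A, ε⟩, hA, hε, -⟩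
    obtain ⟨A', hA', hlt⟩ := IsNondegenerateRealization.exists_extension
      (G := G.comap (Fin.val : Fin (n + 1) → ℕ)) hlam hA hε
    obtain ⟨ε', hε', hle, hedge⟩ := hA'.hasGraph.exists_pos_mul_le_abs (half_pos hε)
    exact ⟨⟨(A', ε'), hA', hε', hedge⟩, hle, hlt⟩
  choose f hf1 hf2 using hstep
  have h0 : P 0 (0, 1) :=
    ⟨⟨Subsingleton.elim _ _, fun i => i.elim0, fun i => i.elim0, by simp⟩, one_pos,
      fun i => i.elim0⟩
  let s : (n : ℕ) → {p // P n p} := fun n => Nat.rec ⟨(0, 1), h0⟩ f n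
  exact ⟨fun n => (s n).1.1, fun n => (s n).1.2, fun n => (s n).2.1, fun n => (s n).2.2.1, le_rfl,
    fun n => hf1 n (s n), fun n => (s n).2.2.2, fun n => hf2 n (s n)⟩

/-! ### The approximating operators and their limit -/

theorem extendByDiagonal_apply_of_lt {n : ℕ} (A : Matrix (Fin n) (Fin n) ℝ) (lam : ℕ → ℝ)
    {i j : ℕ} (hi : i < n) (hj : j < n) : extendByDiagonal A lam i j = A ⟨i, hi⟩ ⟨j, hj⟩ :=
  dif_pos ⟨hi, hj⟩

theorem extendByDiagonal_apply_of_not_lt {n : ℕ} (A : Matrix (Fin n) (Fin n) ℝ) (lam : ℕ → ℝ)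
    {i j : ℕ} (h : ¬ (i < n ∧ j < n)) :
    extendByDiagonal A lam i j = Matrix.diagonal lam i j := by
  rw [extendByDiagonal, dif_neg h, Matrix.diagonal_apply]

theorem exists_hasStandardMatrix_extendByDiagonal {lam : ℕ → ℝ} {K : ℝ}
    (hK : ∀ i, |lam i| ≤ K) {n : ℕ} (A : Matrix (Fin n) (Fin n) ℝ) :
    ∃ S : EllTwo →L[ℂ] EllTwo, HasStandardMatrix S (extendByDiagonal A lam) := by
  obtain ⟨D, hD⟩ := exists_hasStandardMatrix_diagonal lam hK
  obtain ⟨F, hF, -⟩ := exists_hasStandardMatrix_of_finite_support n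
    (extendByDiagonal A lam - Matrix.diagonal lam) fun i j h => by
      rw [Matrix.sub_apply, extendByDiagonal_apply_of_not_lt A lam h, sub_self]
  exact ⟨D + F, by simpa using hD.add hF⟩

/-- Consecutive extended matrices differ only in the leading `(n + 1) × (n + 1)` block. -/
theorem norm_sub_le_of_hasStandardMatrix_extendByDiagonal {lam : ℕ → ℝ} {n : ℕ}
    {A : Matrix (Fin n) (Fin n) ℝ} {A' : Matrix (Fin (n + 1)) (Fin (n + 1)) ℝ}
    {S S' : EllTwo →L[ℂ] EllTwo} (hS : HasStandardMatrix S (extendByDiagonal A lam))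
    (hS' : HasStandardMatrix S' (extendByDiagonal A' lam)) :
    ‖S' - S‖ ≤ ∑ i, ∑ j, |A' i j - extendByDiagonal A lam i j| := by
  obtain ⟨F, hF, hnorm⟩ := exists_hasStandardMatrix_of_finite_support (n + 1)
    (extendByDiagonal A' lam - extendByDiagonal A lam) fun i j h => by
      rw [Matrix.sub_apply, extendByDiagonal_apply_of_not_lt A' lam h,
        extendByDiagonal_apply_of_not_lt A lam (by omega), sub_self]
  rw [(hS'.sub hS).ext hF]
  refine hnorm.trans_eq (Finset.sum_congr rfl fun i _ => Finset.sum_congr rfl fun j _ => ?_)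
  rw [Matrix.sub_apply, extendByDiagonal_apply_of_lt A' lam i.2 j.2]

/-- Norm convergence of operators implies convergence of the matrix entries; in particular the limit
again has a real standard matrix. -/
theorem exists_hasStandardMatrix_of_tendsto {S : ℕ → EllTwo →L[ℂ] EllTwo} {T : EllTwo →L[ℂ] EllTwo}
    (hST : Tendsto S atTop (𝓝 T)) {M : ℕ → Matrix ℕ ℕ ℝ} (hS : ∀ n, HasStandardMatrix (S n) (M n)) :
    ∃ N : Matrix ℕ ℕ ℝ, HasStandardMatrix T N ∧
      ∀ i j, Tendsto (fun n => M n i j) atTop (𝓝 (N i j)) := by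
  have hlim : ∀ i j, Tendsto (fun n => (M n i j : ℂ)) atTop
      (𝓝 ((T (stdVec j) : ℕ → ℂ) i)) := by
    intro i j
    have hcont : Continuous fun R : EllTwo →L[ℂ] EllTwo => inner ℂ (stdVec i) (R (stdVec j)) := by
      fun_prop
    have := (hcont.tendsto T).comp hST
    simpa only [Function.comp_def, inner_stdVec_left, hS _ i j] using this
  have hre : ∀ i j, Tendsto (fun n => M n i j) atTop (𝓝 ((T (stdVec j) : ℕ → ℂ) i).re) :=
    fun i j => (Complex.continuous_re.tendsto _).comp (hlim i j)
  refine ⟨Matrix.of fun i j => ((T (stdVec j) : ℕ → ℂ) i).re, fun i j => ?_, hre⟩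
  exact tendsto_nhds_unique (hlim i j) ((Complex.continuous_ofReal.tendsto _).comp (hre i j))

theorem mem_approxPointSpectrum_of_tendsto_eigenvector {S : ℕ → EllTwo →L[ℂ] EllTwo}
    {T : EllTwo →L[ℂ] EllTwo} (hST : Tendsto S atTop (𝓝 T)) (μ : ℂ)
    (h : ∀ᶠ n in atTop, ∃ v : EllTwo, ‖v‖ = 1 ∧ S n v = μ • v) : μ ∈ approxPointSpectrum T := by
  intro ε hε
  have hclose : ∀ᶠ n in atTop, ‖S n - T‖ < ε := by
    have := Metric.tendsto_nhds.1 hST ε hε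
    simpa only [dist_eq_norm] using this
  obtain ⟨n, ⟨v, hv, hSv⟩, hn⟩ := (h.and hclose).exists
  refine ⟨v, hv, ?_⟩
  rw [← hSv, norm_sub_rev, ← sub_apply]
  calc _ ≤ ‖S n - T‖ * ‖v‖ := (S n - T).le_opNorm v
    _ < ε := by rwa [hv, mul_one]

/-- Eigenvalues of the finite block `A` are eigenvalues of `A ⊕ diag`. -/
theorem HasStandardMatrix.exists_eigenvector {n : ℕ} {S : EllTwo →L[ℂ] EllTwo}
    {A : Matrix (Fin n) (Fin n) ℝ} {lam : ℕ → ℝ}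
    (hS : HasStandardMatrix S (extendByDiagonal A lam)) {s : ℝ} (hs : s ∈ spectrum ℝ A) :
    ∃ v : EllTwo, ‖v‖ = 1 ∧ S v = (s : ℂ) • v := by
  rw [Matrix.mem_spectrum_iff_det_eq_zero] at hs
  obtain ⟨x, hx0, hx⟩ := Matrix.exists_mulVec_eq_zero_iff.2 hs
  let y : EuclideanSpace ℂ (Fin n) := WithLp.toLp 2 fun i => (x i : ℂ)
  have hAx : A.mulVec x = s • x := by
    rw [Matrix.sub_mulVec, Matrix.smul_mulVec, Matrix.one_mulVec, sub_eq_zero] at hx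
    exact hx.symm
  have hy : Matrix.toEuclideanLin (A.map Complex.ofReal) y = (s : ℂ) • y := by
    ext i
    have := congrArg (fun r : ℝ => (r : ℂ)) (congrFun hAx i)
    simpa [Matrix.toLpLin_apply, Matrix.mulVec, dotProduct, y] using this
  have hy0 : y ≠ 0 := by
    intro h
    refine hx0 (funext fun i => ?_)
    have := congrArg (fun z : EuclideanSpace ℂ (Fin n) => z i) h
    simpa [y] using this
  have hnorm : (‖includeFin y‖ : ℂ) ≠ 0 := by
    rw [norm_includeFin]
    exact_mod_cast norm_ne_zero_iff.2 hy0
  refine ⟨(‖includeFin y‖ : ℂ)⁻¹ • includeFin y, ?_, ?_⟩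
  · rw [norm_smul, norm_inv, Complex.norm_real, norm_norm]
    exact inv_mul_cancel₀ (by exact_mod_cast hnorm)
  · rw [map_smul, hS.apply_includeFin, hy, includeFin_smul, smul_comm]

/-- The lower bounds for the finite sections pass to the limit operator: on a vector truncated to
the first `n` coordinates, `S n` acts as the finite matrix `A n`. -/
theorem mul_norm_le_norm_sub_of_tendsto {S : ℕ → EllTwo →L[ℂ] EllTwo} {T : EllTwo →L[ℂ] EllTwo}
    (hST : Tendsto S atTop (𝓝 T)) {A : (n : ℕ) → Matrix (Fin n) (Fin n) ℝ} {lam : ℕ → ℝ}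
    (hA : ∀ n, (A n).IsSymm) (hS : ∀ n, HasStandardMatrix (S n) (extendByDiagonal (A n) lam))
    (μ : ℂ) {δ : ℝ} (hδ : 0 ≤ δ) (h : ∀ n, ∀ s ∈ spectrum ℝ (A n), δ ≤ ‖(s : ℂ) - μ‖)
    (v : EllTwo) : δ * ‖v‖ ≤ ‖T v - μ • v‖ := by
  let w : (n : ℕ) → EuclideanSpace ℂ (Fin n) := fun n => WithLp.toLp 2 fun i : Fin n => v i
  have hw : Tendsto (fun n => includeFin (w n)) atTop (𝓝 v) := tendsto_includeFin v
  have hSw : Tendsto (fun n => S n (includeFin (w n))) atTop (𝓝 (T v)) :=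
    ((isBoundedBilinearMap_apply (𝕜 := ℂ) (E := EllTwo) (F := EllTwo)).continuous.tendsto (T, v)).comp
      (hST.prodMk_nhds hw)
  refine le_of_tendsto_of_tendsto' (hw.norm.const_mul δ) (hSw.sub (hw.const_smul μ)).norm
    fun n => ?_
  rw [(hS n).apply_includeFin, ← includeFin_smul, ← includeFin_sub, norm_includeFin,
    norm_includeFin]
  exact (hA n).mul_norm_le_norm_toEuclideanLin_sub μ hδ (h n) (w n)

/-- The limit matrix inherits the zero entries off the diagonal, and an entry at an edge `i j` keeps
at least half of the absolute value it has when both vertices have just appeared. -/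
theorem hasGraph_of_tendsto {G : SimpleGraph ℕ} {lam ε : ℕ → ℝ}
    {A : (n : ℕ) → Matrix (Fin n) (Fin n) ℝ} {N : Matrix ℕ ℕ ℝ}
    (hN : ∀ i j, Tendsto (fun n => extendByDiagonal (A n) lam i j) atTop (𝓝 (N i j)))
    (hA : ∀ n, HasGraph (A n) (G.comap (Fin.val : Fin n → ℕ)))
    (hε : ∀ n, 0 < ε n) (hhalf : ∀ n, ε (n + 1) ≤ ε n / 2)
    (hedge : ∀ n (i j : Fin n), G.Adj i j → 4 * ε n ≤ |A n i j|)
    (hstep : ∀ n, ∑ i, ∑ j, |A (n + 1) i j - extendByDiagonal (A n) lam i j| < ε n) :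
    HasGraph N G := by
  intro i j hij
  constructor
  · intro hne
    by_contra hadj
    refine hne (tendsto_nhds_unique (hN i j) ?_)
    have : (fun n => extendByDiagonal (A n) lam i j) = fun _ => 0 := by
      funext n
      by_cases h : i < n ∧ j < n
      · rw [extendByDiagonal_apply_of_lt _ _ h.1 h.2]
        by_contra hne'
        exact hadj ((hA n ⟨i, h.1⟩ ⟨j, h.2⟩ (fun h => hij (congrArg Fin.val h))).1 hne')
      · rw [extendByDiagonal_apply_of_not_lt _ _ h, Matrix.diagonal_apply_ne _ hij]
    rw [this]
    exact tendsto_const_nhds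
  · intro hadj
    set m := max i j + 1 with hm
    have hi : ∀ k, m ≤ k → i < k := fun k hk => by omega
    have hj : ∀ k, m ≤ k → j < k := fun k hk => by omega
    -- the geometric tail `∑ k ≥ m, ε k ≤ 2 * ε m`, in telescoped form
    have hbound : ∀ k, m ≤ k → |extendByDiagonal (A k) lam i j - extendByDiagonal (A m) lam i j| ≤
        2 * ε m - 2 * ε k := by
      intro k hk
      induction k, hk using Nat.le_induction with
      | base => simp
      | succ k hk ih =>
        have h1 : |extendByDiagonal (A (k + 1)) lam i j - extendByDiagonal (A k) lam i j| ≤ ε k := by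
          refine le_trans ?_ (hstep k).le
          have hi' : i < k + 1 := hi _ (by omega)
          have hj' : j < k + 1 := hj _ (by omega)
          rw [extendByDiagonal_apply_of_lt (A (k + 1)) lam hi' hj']
          refine le_trans ?_ (Finset.single_le_sum (fun a _ => Finset.sum_nonneg fun b _ =>
            abs_nonneg _) (Finset.mem_univ (⟨i, hi'⟩ : Fin (k + 1))))
          exact Finset.single_le_sum (f := fun b : Fin (k + 1) =>
            |A (k + 1) ⟨i, hi'⟩ b - extendByDiagonal (A k) lam i b|) (fun b _ => abs_nonneg _)
            (Finset.mem_univ (⟨j, hj'⟩ : Fin (k + 1)))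
        have h2 := abs_sub_le (extendByDiagonal (A (k + 1)) lam i j)
          (extendByDiagonal (A k) lam i j) (extendByDiagonal (A m) lam i j)
        have h3 := hhalf k
        linarith
    have hm4 : 4 * ε m ≤ |extendByDiagonal (A m) lam i j| := by
      rw [extendByDiagonal_apply_of_lt _ _ (hi m le_rfl) (hj m le_rfl)]
      exact hedge m _ _ hadj
    have hlim : 2 * ε m ≤ |N i j| := by
      refine ge_of_tendsto (hN i j).abs (eventually_atTop.2 ⟨m, fun k hk => ?_⟩)
      have h1 := hbound k hk
      have h2 := abs_sub_abs_le_abs_sub (extendByDiagonal (A m) lam i j)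
        (extendByDiagonal (A k) lam i j)
      rw [abs_sub_comm] at h1
      have h3 := hε k
      linarith
    have := hε m
    exact abs_pos.1 (by linarith)

theorem mainTheorem1 {V : Type*} [Countable V] [Infinite V] (G : SimpleGraph V)
    (Λ : Set ℝ) (hcompact : IsCompact Λ) (hinfinite : Λ.Infinite) :
    Nonempty (ℕ ≃ V) ∧
    (∃ lam : ℕ → ℝ, EnumeratesDenseSubset lam Λ) ∧
    ∀ (e : ℕ ≃ V) (lam : ℕ → ℝ), EnumeratesDenseSubset lam Λ →
      ∃ (A : (n : ℕ) → Matrix (Fin n) (Fin n) ℝ)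
        (S : ℕ → (EllTwo →L[ℂ] EllTwo)) (T : EllTwo →L[ℂ] EllTwo),
        SolvesSISP (G.comap e) Λ T ∧
        (∀ n : ℕ, SolvesFiniteSIEP (G.comap (fun i : Fin n => e i)) lam (A n)) ∧
        (∀ n : ℕ, HasStandardMatrix (S n) (extendByDiagonal (A n) lam)) ∧
        (∀ n : ℕ, ‖S (n + 1) - S n‖ < (1 / 2 : ℝ) ^ n) ∧
        Tendsto S atTop (𝓝 T) := by
  refine ⟨inferInstance, exists_enumeratesDenseSubset hinfinite, ?_⟩
  rintro e lam ⟨hinj, hsub, hdense⟩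
  obtain ⟨A, ε, hA, hε, hε0, hhalf, hedge, hstep⟩ :=
    exists_seq_isNondegenerateRealization (G.comap e) hinj
  have hsolve : ∀ n, SolvesFiniteSIEP (G.comap (fun i : Fin n => e i)) lam (A n) :=
    fun n => (hA n).solvesFiniteSIEP hinj
  obtain ⟨K, hK⟩ := hcompact.isBounded.exists_norm_le
  choose S hS using fun n => exists_hasStandardMatrix_extendByDiagonal
    (fun i => hK (lam i) (hsub ⟨i, rfl⟩)) (A n)
  have hεpow : ∀ n, ε n ≤ (1 / 2 : ℝ) ^ n := by
    intro n
    induction n with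
    | zero => simpa using hε0
    | succ n ih =>
      rw [pow_succ]
      linarith [hhalf n]
  have hnorm : ∀ n, ‖S (n + 1) - S n‖ < (1 / 2 : ℝ) ^ n := fun n =>
    ((norm_sub_le_of_hasStandardMatrix_extendByDiagonal (hS n) (hS (n + 1))).trans_lt
      (hstep n)).trans_le (hεpow n)
  obtain ⟨T, hT⟩ := cauchySeq_tendsto_of_complete
    (cauchySeq_of_le_geometric (1 / 2 : ℝ) 1 (by norm_num) (f := S) fun n => by
      rw [dist_comm, dist_eq_norm, one_mul]
      exact (hnorm n).le)
  obtain ⟨N, hTN, hN⟩ := exists_hasStandardMatrix_of_tendsto hT hS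
  have hNsymm : N.IsSymm := by
    ext i j
    refine tendsto_nhds_unique (hN j i) ?_
    simpa only [(extendByDiagonal_isSymm (hA _).isSymm lam).apply] using hN i j
  have hsa := hTN.isSelfAdjoint hNsymm
  -- `lam k` is an eigenvalue of `S n` as soon as `k < n`
  have hlow : (fun x : ℝ => (x : ℂ)) '' Λ ⊆ approxPointSpectrum T := by
    have hlam : ∀ k, (lam k : ℂ) ∈ approxPointSpectrum T := by
      intro k
      refine mem_approxPointSpectrum_of_tendsto_eigenvector hT _ ?_
      filter_upwards [eventually_gt_atTop k] with n hn
      refine (hS n).exists_eigenvector ?_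
      rw [(hsolve n).2.2]
      exact ⟨⟨k, hn⟩, rfl⟩
    have hcl : IsClosed ((fun x : ℝ => (x : ℂ)) ⁻¹' approxPointSpectrum T) :=
      (isClosed_approxPointSpectrum T).preimage Complex.continuous_ofReal
    rw [Set.image_subset_iff]
    exact hdense.trans (hcl.closure_subset_iff.2 (Set.range_subset_iff.2 hlam))
  -- off `Λ` all the finite sections are bounded below by the distance to `Λ`
  have hup : spectrum ℂ T ⊆ (fun x : ℝ => (x : ℂ)) '' Λ := by
    intro μ hμ
    have hre := hsa.mem_spectrum_eq_re hμ
    rw [hre] at hμ ⊢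
    refine ⟨μ.re, ?_, rfl⟩
    by_contra hnot
    obtain ⟨δ, hδ, hball⟩ := Metric.isOpen_iff.1 hcompact.isClosed.isOpen_compl _ hnot
    refine hsa.notMem_spectrum_of_mul_norm_le μ.re hδ (fun v => ?_) hμ
    refine mul_norm_le_norm_sub_of_tendsto hT (fun n => (hA n).isSymm) hS _ hδ.le ?_ v
    intro n s hs
    rw [(hsolve n).2.2] at hs
    obtain ⟨k, rfl⟩ := hs
    by_contra hlt
    refine hball ?_ (hsub ⟨k, rfl⟩)
    rw [Metric.mem_ball, dist_eq_norm]
    rw [← Complex.ofReal_sub, Complex.norm_real] at hlt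
    exact not_le.1 hlt
  have happ := approxPointSpectrum_subset_spectrum T
  exact ⟨A, S, T, ⟨hsa, hup.antisymm (hlow.trans happ), (happ.trans hup).antisymm hlow, N, hNsymm,
    hTN, hasGraph_of_tendsto hN (fun n => (hA n).hasGraph) hε hhalf hedge hstep⟩, hsolve, hS, hnorm,
    hT⟩
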